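/- Let $k\ge 2$ and $t\ge 2$ be integers and let $c>0$ be a real number. Let $T(k,t,c)$ be the $t\times t$ tridiagonal matrix with lower diagonal $(1,1,\ldots,1,c)$, upper diagonal $(k,k-1,\ldots,k-1)$ and constant row sum $k$, and let $$M(k,t,c)=1+\sum_{i=0}^{t-3}k(k-1)^i+\frac{k(k-1)^{t-2}}{c}.$$ (All eigenvalues of $T(k,t,c)$ are real.) Let $H$ be a finite connected $k$-regular graph with at least $M(k,t,c)$ vertices, let $\lambda_2(H)$ be the second largest eigenvalue of the adjacency matrix of $H$, and let $\lambda_2$ be the second largest eigenvalue of $T(k,t,c)$, eigenvalues being counted with multiplicity. Then $\lambda_2\le\lambda_2(H)$, and if $\lambda_2=\lambda_2(H)$, then $H$ meets the bound $M(k,t,c)$, that is, $H$ has exactly $M(k,t,c)$ vertices. -/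

import Mathlib

namespace RegularGraphBound

open Matrix

/-- The `i`-th largest (counting from `0`) real eigenvalue of a square real matrix, eigenvalues
being listed in decreasing order with multiplicity as roots of the characteristic polynomial.
The default value `0` is used only when there are at most `i` real eigenvalues. -/
noncomputable def nthLargestEigenvalue {n : Type*} [Fintype n] [DecidableEq n]
    (A : Matrix n n ℝ) (i : ℕ) : ℝ :=
  (A.charpoly.roots.sort (· ≥ ·)).getD i 0

/-- The second largest eigenvalue of a square real matrix, counted with multiplicity. -/
noncomputable def secondEigenvalue {n : Type*} [Fintype n] [DecidableEq n]
    (A : Matrix n n ℝ) : ℝ :=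
  nthLargestEigenvalue A 1

/-- The second largest eigenvalue `λ₂(G)` of (the adjacency matrix of) a finite graph. -/
noncomputable def graphSecondEigenvalue {V : Type*} [Fintype V] [DecidableEq V]
    (G : SimpleGraph V) [DecidableRel G.Adj] : ℝ :=
  secondEigenvalue (G.adjMatrix ℝ)

/-- The off-diagonal part of `T(k,t,c)`: lower diagonal `(1, 1, …, 1, c)`,
upper diagonal `(k, k - 1, …, k - 1)`, zeros elsewhere (rows and columns indexed from `0`). -/
noncomputable def offDiagT (k t : ℕ) (c : ℝ) : Matrix (Fin t) (Fin t) ℝ :=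
  Matrix.of fun i j =>
    if (i : ℕ) = (j : ℕ) + 1 then (if (i : ℕ) + 1 = t then c else 1)
    else if (j : ℕ) = (i : ℕ) + 1 then (if (i : ℕ) = 0 then (k : ℝ) else (k : ℝ) - 1)
    else 0

/-- The tridiagonal `t × t` matrix `T(k,t,c)` with lower diagonal `(1, …, 1, c)`, upper diagonal
`(k, k - 1, …, k - 1)`, and constant row sum `k`. -/
noncomputable def matrixT (k t : ℕ) (c : ℝ) : Matrix (Fin t) (Fin t) ℝ :=
  offDiagT k t c + Matrix.diagonal fun i => (k : ℝ) - ∑ j, offDiagT k t c i j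

/-- `M(k,t,c) = 1 + ∑_{i=0}^{t-3} k (k-1)^i + k (k-1)^(t-2) / c`, for `t ≥ 2`. -/
noncomputable def boundM (k t : ℕ) (c : ℝ) : ℝ :=
  1 + ∑ i ∈ Finset.range (t - 2), (k : ℝ) * ((k : ℝ) - 1) ^ i
    + (k : ℝ) * ((k : ℝ) - 1) ^ (t - 2) / c

/-- All rows of `T(k,t,c)` sum to `k`. -/
theorem matrixT_row_sum (k t : ℕ) (c : ℝ) (i : Fin t) : ∑ j, matrixT k t c i j = k := by
  simp [matrixT, Finset.sum_add_distrib, Matrix.diagonal_apply]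

/-- The eigenvalues of `T(k,t,c)` are all real, so that listing them in decreasing order makes
sense and there are `t` of them. -/
theorem matrixT_charpoly_splits (k t : ℕ) (c : ℝ) (hk : 2 ≤ k) (hc : 0 < c) :
    (matrixT k t c).charpoly.Splits := by
  have hk' : (2 : ℝ) ≤ k := by exact_mod_cast hk
  let u : ℕ → ℝ := fun j => if j = 0 then (k : ℝ) else (k : ℝ) - 1
  let l : ℕ → ℝ := fun j => if j + 2 = t then c else 1
  have hu : ∀ j, 0 < u j := fun j => by simp only [u]; split_ifs <;> linarith
  have hl : ∀ j, 0 < l j := fun j => by simp only [l]; split_ifs <;> linarith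
  let d : ℕ → ℝ := fun n => ∏ j ∈ Finset.range n, Real.sqrt (u j / l j)
  have hd : ∀ n, 0 < d n := fun n =>
    Finset.prod_pos fun j _ => Real.sqrt_pos.2 (div_pos (hu j) (hl j))
  have hdd : ∀ n, d (n + 1) ^ 2 * l n = d n ^ 2 * u n := fun n => by
    have h1 : d (n + 1) = d n * Real.sqrt (u n / l n) := Finset.prod_range_succ _ _
    rw [h1, mul_pow, Real.sq_sqrt (div_pos (hu n) (hl n)).le]
    have := (hl n).ne'
    field_simp
  let D : Matrix (Fin t) (Fin t) ℝ := Matrix.diagonal fun i => d i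
  let E : Matrix (Fin t) (Fin t) ℝ := Matrix.diagonal fun i => (d i)⁻¹
  have hDE : D * E = 1 := by
    simp only [D, E, Matrix.diagonal_mul_diagonal]
    rw [← Matrix.diagonal_one]
    congr 1
    funext i
    exact mul_inv_cancel₀ (hd i).ne'
  have hED : E * D = 1 := by
    simp only [D, E, Matrix.diagonal_mul_diagonal]
    rw [← Matrix.diagonal_one]
    congr 1
    funext i
    exact inv_mul_cancel₀ (hd i).ne'
  have hconj : (matrixT k t c).charpoly = (D * matrixT k t c * E).charpoly := by
    rw [Matrix.mul_assoc, Matrix.charpoly_mul_comm, Matrix.mul_assoc, hED, Matrix.mul_one]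
  rw [hconj]
  have key : ∀ i j : Fin t, (i : ℕ) = (j : ℕ) + 1 →
      d i * matrixT k t c i j * (d j)⁻¹ = d j * matrixT k t c j i * (d i)⁻¹ := by
    intro i j hij
    have hne : i ≠ j := fun h => by rw [h] at hij; omega
    have e1 : matrixT k t c i j = l j := by
      simp only [matrixT, offDiagT, l, Matrix.add_apply, Matrix.of_apply,
        Matrix.diagonal_apply_ne _ hne, hij, add_assoc, if_true, add_zero, Nat.reduceAdd]
    have e2 : matrixT k t c j i = u j := by
      have h : ¬ ((j : ℕ) = (i : ℕ) + 1) := by omega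
      simp only [matrixT, offDiagT, u, Matrix.add_apply, Matrix.of_apply,
        Matrix.diagonal_apply_ne _ hne.symm, add_zero]
      rw [if_neg h, if_pos hij]
    rw [e1, e2, hij]
    have h1 := (hd j).ne'
    have h2 := (hd (j + 1)).ne'
    have h3 := hdd j
    field_simp
    linarith
  apply Matrix.IsHermitian.splits_charpoly
  ext i j
  have hent : ∀ i j : Fin t, (D * matrixT k t c * E) i j
      = d i * matrixT k t c i j * (d j)⁻¹ := fun i j => by
    simp [D, E, Matrix.mul_diagonal, Matrix.diagonal_mul]
  simp only [Matrix.conjTranspose_apply, star_trivial]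
  rw [hent, hent]
  by_cases h1 : (i : ℕ) = (j : ℕ) + 1
  · exact (key i j h1).symm
  by_cases h2 : (j : ℕ) = (i : ℕ) + 1
  · exact key j i h2
  by_cases h3 : i = j
  · rw [h3]
  · simp [matrixT, offDiagT, h1, h2, h3, Ne.symm (a := i) h3]

end RegularGraphBound

namespace RegularGraphBound

open Matrix Polynomial

/-! This is a linear programming bound. Write `F_n` for the nonbacktracking polynomials, `G_n` for
their partial sums, `m = t - 2`, `A` for the adjacency matrix and `l` for the second eigenvalue of
`T`. By `charpoly_matrixT`, `l` is the largest root of `Q = F_{m+1} + c G_m`, and `Q(k) = c M`.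
Christoffel–Darboux gives `(X - l) p = w_m Q`, where `p = ∑ w_j G_j` has positive weights `w_j`.

Suppose `λ₂(H) ≤ l` and compute `w_m tr(Q(A) p(A)) = tr((A - l) p(A)²)` in two ways. On the
spectrum, `k` contributes `w_m c M p(k)` and every other eigenvalue at most `0`. On the walk side,
the entries of `F_n(A)` are natural numbers, so `tr(F_{m+1}(A) p(A)) ≥ 0` and `tr(G_m(A) p(A)) ≥ |V|
p(k)`. Hence `|V| ≤ M`. If `λ₂(H) < l` and `|V| ≥ M`, then `p` vanishes at all other eigenvalues, so
`tr(F_{m+1}(A) p(A)) = F_{m+1}(k) p(k) > 0`: a contradiction. The theorem is the contrapositive. -/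

/-! ### Nonbacktracking polynomials: recurrences and positivity. -/

/-- The upper diagonal entries `k, k - 1, k - 1, …` of `T(k,t,c)`. -/
def upperEntry (k : ℝ) (n : ℕ) : ℝ := if n = 0 then k else k - 1

/-- The polynomials `F_n` with `F_n(A)` counting the nonbacktracking walks of length `n` in a
`k`-regular graph with adjacency matrix `A`. -/
noncomputable def nonbacktrackingPoly (k : ℝ) : ℕ → ℝ[X]
  | 0 => 1
  | 1 => X
  | n + 2 => X * nonbacktrackingPoly k (n + 1) - C (upperEntry k n) * nonbacktrackingPoly k n

/-- The partial sums `G_n = F_0 + ⋯ + F_n` of the nonbacktracking polynomials. -/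
noncomputable def nonbacktrackingSum (k : ℝ) (n : ℕ) : ℝ[X] :=
  ∑ i ∈ Finset.range (n + 1), nonbacktrackingPoly k i

/-- The polynomial `F_{m+1} + c G_m`, which is the characteristic polynomial of `T(k,m+2,c)`
divided by `X - k`. -/
noncomputable def quotientPoly (k c : ℝ) (m : ℕ) : ℝ[X] :=
  nonbacktrackingPoly k (m + 1) + C c * nonbacktrackingSum k m

lemma nonbacktrackingSum_zero (k : ℝ) : nonbacktrackingSum k 0 = 1 := by
  simp [nonbacktrackingSum, nonbacktrackingPoly]

lemma nonbacktrackingSum_one (k : ℝ) : nonbacktrackingSum k 1 = 1 + X := by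
  simp [nonbacktrackingSum, nonbacktrackingPoly, Finset.sum_range_succ]

lemma nonbacktrackingSum_succ (k : ℝ) (n : ℕ) :
    nonbacktrackingSum k (n + 1) = nonbacktrackingSum k n + nonbacktrackingPoly k (n + 1) :=
  Finset.sum_range_succ _ _

lemma nonbacktrackingPoly_add_two (k : ℝ) (n : ℕ) :
    nonbacktrackingPoly k (n + 2) =
      X * nonbacktrackingPoly k (n + 1) - C (upperEntry k n) * nonbacktrackingPoly k n := rfl

/-- The sum telescopes because the coefficients `1` and `k - 1` of the recurrence add up to `k`. -/
lemma X_sub_mul_nonbacktrackingSum (k : ℝ) (n : ℕ) :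
    (X - C k) * nonbacktrackingSum k n =
      nonbacktrackingPoly k (n + 1) - C (upperEntry k n) * nonbacktrackingPoly k n := by
  induction n with
  | zero => simp [nonbacktrackingSum_zero, nonbacktrackingPoly, upperEntry]
  | succ n ih =>
    rw [nonbacktrackingSum_succ, mul_add, ih, nonbacktrackingPoly_add_two]
    simp [upperEntry]
    ring

/-- Unlike the `F_n`, the `G_n` obey a recurrence with no exceptional first coefficient; this keeps
Christoffel–Darboux simple. -/
lemma nonbacktrackingSum_add_two (k : ℝ) (n : ℕ) :
    nonbacktrackingSum k (n + 2) =
      X * nonbacktrackingSum k (n + 1) - C (k - 1) * nonbacktrackingSum k n := by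
  induction n with
  | zero =>
    rw [nonbacktrackingSum_succ, zero_add, nonbacktrackingSum_one, nonbacktrackingSum_zero,
      nonbacktrackingPoly_add_two]
    simp [nonbacktrackingPoly, upperEntry]
    ring
  | succ n ih =>
    have h1 := nonbacktrackingSum_succ k n
    have h2 := nonbacktrackingSum_succ k (n + 1)
    rw [nonbacktrackingSum_succ, nonbacktrackingPoly_add_two]
    simp only [upperEntry, Nat.add_eq_zero_iff, one_ne_zero, and_false, if_false]
    linear_combination ih - X * h2 + C (k - 1) * h1

lemma eval_nonbacktrackingPoly_pos {k x : ℝ} (hk : 2 ≤ k) (hx : k ≤ x) (n : ℕ) :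
    0 < (nonbacktrackingPoly k n).eval x := by
  -- Positivity alone does not propagate through the subtraction in the recurrence; the growth bound
  -- does.
  suffices h : 0 < (nonbacktrackingPoly k n).eval x ∧
      upperEntry k n * (nonbacktrackingPoly k n).eval x
        ≤ (nonbacktrackingPoly k (n + 1)).eval x from h.1
  induction n with
  | zero => simpa [nonbacktrackingPoly, upperEntry] using hx
  | succ n ih =>
    have hu : 0 < upperEntry k n := by unfold upperEntry; split_ifs <;> linarith
    have h1 : 0 < (nonbacktrackingPoly k (n + 1)).eval x := (mul_pos hu ih.1).trans_le ih.2
    refine ⟨h1, ?_⟩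
    rw [nonbacktrackingPoly_add_two]
    simp only [upperEntry, Nat.add_eq_zero_iff, one_ne_zero, and_false, if_false, eval_sub,
      eval_mul, eval_X, eval_C]
    have h2 := ih.2
    simp only [upperEntry] at h2
    nlinarith [mul_nonneg (sub_nonneg.2 hx) h1.le]

lemma eval_nonbacktrackingSum_pos {k x : ℝ} (hk : 2 ≤ k) (hx : k ≤ x) (n : ℕ) :
    0 < (nonbacktrackingSum k n).eval x := by
  rw [nonbacktrackingSum, eval_finsetSum]
  exact Finset.sum_pos (fun i _ => eval_nonbacktrackingPoly_pos hk hx i) ⟨0, by simp⟩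

lemma eval_quotientPoly_pos {k c x : ℝ} (hk : 2 ≤ k) (hc : 0 < c) (hx : k ≤ x) (m : ℕ) :
    0 < (quotientPoly k c m).eval x := by
  simp only [quotientPoly, eval_add, eval_mul, eval_C]
  exact add_pos (eval_nonbacktrackingPoly_pos hk hx _)
    (mul_pos hc (eval_nonbacktrackingSum_pos hk hx _))

lemma eval_nonbacktrackingPoly_self (k : ℝ) (n : ℕ) :
    (nonbacktrackingPoly k (n + 1)).eval k = k * (k - 1) ^ n := by
  have h := congrArg (eval k) (X_sub_mul_nonbacktrackingSum k n)
  simp only [eval_mul, eval_sub, eval_X, eval_C, sub_self, zero_mul] at h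
  induction n with
  | zero => simp [nonbacktrackingPoly]
  | succ n ih =>
    have h' := congrArg (eval k) (X_sub_mul_nonbacktrackingSum k n)
    simp only [eval_mul, eval_sub, eval_X, eval_C, sub_self, zero_mul] at h'
    rw [ih h'] at h
    simp only [upperEntry, Nat.add_eq_zero_iff, one_ne_zero, and_false, if_false] at h
    rw [pow_succ]
    linarith

/-- This is where the vertex bound enters the spectral argument. -/
lemma eval_quotientPoly_self {k : ℕ} {c : ℝ} (hc : 0 < c) (m : ℕ) :
    (quotientPoly k c m).eval (k : ℝ) = c * boundM k (m + 2) c := by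
  simp only [quotientPoly, eval_add, eval_mul, eval_C, eval_nonbacktrackingPoly_self,
    nonbacktrackingSum, eval_finsetSum, Finset.sum_range_succ', boundM, Nat.add_sub_cancel]
  simp only [nonbacktrackingPoly, eval_one]
  field_simp
  ring

/-- A Christoffel–Darboux formula for the polynomials `G_n`. -/
lemma christoffel_darboux {k : ℝ} (hk : k - 1 ≠ 0) (l : ℝ) (m : ℕ) :
    (X - C l) * ∑ j ∈ Finset.range (m + 1),
        C ((nonbacktrackingSum k j).eval l / (k - 1) ^ j) * nonbacktrackingSum k j =
      C (1 / (k - 1) ^ m) * (C ((nonbacktrackingSum k m).eval l) * nonbacktrackingSum k (m + 1) -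
        C ((nonbacktrackingSum k (m + 1)).eval l) * nonbacktrackingSum k m) := by
  refine Polynomial.funext fun x => ?_
  induction m with
  | zero => simp [nonbacktrackingSum_zero, nonbacktrackingSum_one]
  | succ m ih =>
    rw [Finset.sum_range_succ, mul_add, eval_add, ih, nonbacktrackingSum_add_two]
    simp only [eval_mul, eval_sub, eval_X, eval_C]
    field_simp
    ring

/-- If `l` is a root of `F_{m+1} + c G_m` beyond which that polynomial is nonnegative, then
`G_0, …, G_m` are positive at `l`. -/
lemma eval_nonbacktrackingSum_pos_of_root {k c l : ℝ} (hk : 2 ≤ k) {m : ℕ}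
    (hS : ∀ x, l ≤ x → 0 ≤ (quotientPoly k c m).eval x) {j : ℕ} (hj : j ≤ m) :
    0 < (nonbacktrackingSum k j).eval l := by
  by_contra hneg
  -- At `y = sSup Z`, the last point where positivity fails, all `G_i` with `i ≤ m` are nonnegative
  -- and some vanish. At the least vanishing index `i + 1`, the recurrence makes `G_{i+2}(y)`
  -- negative.
  set Z : Set ℝ := Set.Ici l ∩ ⋃ j ∈ Finset.range (m + 1),
    {x : ℝ | (nonbacktrackingSum k j).eval x ≤ 0} with hZ
  have memZ : ∀ x, x ∈ Z ↔ l ≤ x ∧ ∃ j ≤ m, (nonbacktrackingSum k j).eval x ≤ 0 := by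
    intro x; simp [hZ]
  have hclosed : IsClosed Z := by
    refine isClosed_Ici.inter ?_
    refine (Finset.range (m + 1)).finite_toSet.isClosed_biUnion fun j _ => ?_
    exact isClosed_le (nonbacktrackingSum k j).continuous continuous_const
  have hbdd : BddAbove Z := by
    refine ⟨k, fun x hx => ?_⟩
    obtain ⟨-, i, -, hi⟩ := (memZ x).1 hx
    by_contra! h
    exact absurd (eval_nonbacktrackingSum_pos hk h.le i) (not_lt.2 hi)
  have hne : Z.Nonempty := ⟨l, (memZ l).2 ⟨le_rfl, j, hj, not_lt.1 hneg⟩⟩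
  have hy := hclosed.csSup_mem hne hbdd
  set y := sSup Z
  have habove : ∀ x, y < x → ∀ i ≤ m, 0 < (nonbacktrackingSum k i).eval x := by
    intro x hx i hi
    by_contra! h
    exact absurd (le_csSup hbdd ((memZ x).2 ⟨((memZ y).1 hy).1.trans hx.le, i, hi, h⟩))
      (not_le.2 hx)
  have hnonneg : ∀ i ≤ m, 0 ≤ (nonbacktrackingSum k i).eval y := by
    intro i hi
    have ht : Filter.Tendsto (fun x => (nonbacktrackingSum k i).eval x) (nhdsWithin y (Set.Ioi y))
        (nhds ((nonbacktrackingSum k i).eval y)) :=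
      ((nonbacktrackingSum k i).continuous.tendsto y).mono_left nhdsWithin_le_nhds
    refine ge_of_tendsto ht ?_
    filter_upwards [self_mem_nhdsWithin] with x hx
    exact (habove x hx i hi).le
  classical
  obtain ⟨hly, hex⟩ := (memZ y).1 hy
  obtain ⟨him, hi⟩ := Nat.find_spec hex
  have hmin : ∀ i' < Nat.find hex, 0 < (nonbacktrackingSum k i').eval y := by
    intro i' hi'
    by_contra! h
    exact Nat.find_min hex hi' ⟨hi'.le.trans him, h⟩
  generalize Nat.find hex = i at him hi hmin
  obtain _ | i := i
  · simp [nonbacktrackingSum_zero] at hi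
    linarith
  have h0 : (nonbacktrackingSum k (i + 1)).eval y = 0 := le_antisymm hi (hnonneg _ him)
  have h1 := hmin i (Nat.lt_succ_self i)
  have h2 : (nonbacktrackingSum k (i + 2)).eval y < 0 := by
    rw [nonbacktrackingSum_add_two]
    simp only [eval_mul, eval_sub, eval_X, eval_C, h0, mul_zero, zero_sub]
    have : 0 < (k - 1) * (nonbacktrackingSum k i).eval y := mul_pos (by linarith) h1
    linarith
  rcases him.lt_or_eq with h | h
  · exact absurd (hnonneg (i + 2) h) (not_le.2 h2)
  -- Here `i + 1 = m`: since `G_m(y) = 0`, both `G_{m+1}(y)` and `Q(y)` equal `F_{m+1}(y)`.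
  · have := hS y hly
    subst h
    rw [nonbacktrackingSum_succ, eval_add, h0, zero_add] at h2
    simp only [quotientPoly, eval_add, eval_mul, eval_C, h0, mul_zero, add_zero] at this
    linarith

/-! ### The characteristic polynomial of `T`. -/

lemma matrixT_apply_of_eq_succ (k t : ℕ) (c : ℝ) {i j : Fin t} (h : (i : ℕ) = j + 1) :
    matrixT k t c i j = if (i : ℕ) + 1 = t then c else 1 := by
  have hne : i ≠ j := fun h' => by rw [h'] at h; omega
  simp [matrixT, offDiagT, h, hne]

lemma matrixT_apply_of_succ_eq (k t : ℕ) (c : ℝ) {i j : Fin t} (h : (j : ℕ) = i + 1) :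
    matrixT k t c i j = upperEntry k i := by
  have hne : i ≠ j := fun h' => by rw [h'] at h; omega
  have h2 : ¬ (i : ℕ) = j + 1 := by omega
  simp only [matrixT, offDiagT, Matrix.add_apply, Matrix.of_apply, if_neg h2, if_pos h,
    Matrix.diagonal_apply_ne _ hne, add_zero, upperEntry]

lemma matrixT_apply_of_far (k t : ℕ) (c : ℝ) {i j : Fin t} (h : (j : ℕ) ≠ i + 1)
    (h' : (i : ℕ) ≠ j + 1) (hne : i ≠ j) : matrixT k t c i j = 0 := by
  simp [matrixT, offDiagT, h, h', hne]

lemma sum_offDiagT (k m : ℕ) (c : ℝ) (i : Fin (m + 2)) :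
    ∑ j, offDiagT k (m + 2) c i j = if (i : ℕ) = m + 1 then c else k := by
  have hi := i.2
  let f : ℕ → ℝ := fun n => (if n + 1 = i then (if (i : ℕ) = m + 1 then c else 1) else 0) +
    (if n = i + 1 then upperEntry k i else 0)
  have h : ∀ j : Fin (m + 2), offDiagT k (m + 2) c i j = f j := by
    intro j
    simp only [f, offDiagT, Matrix.of_apply, upperEntry]
    split_ifs <;> first | omega | simp
  rw [Finset.sum_congr rfl fun j _ => h j, Fin.sum_univ_eq_sum_range f]
  simp only [f]
  rw [Finset.sum_add_distrib, Finset.sum_ite_eq', upperEntry]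
  obtain h0 | ⟨n, hn⟩ : (i : ℕ) = 0 ∨ ∃ n, (i : ℕ) = n + 1 :=
    (Nat.eq_zero_or_eq_succ_pred _).imp id fun h => ⟨_, h⟩
  · simp [h0]
  · simp only [hn, add_left_inj, Finset.sum_ite_eq', Finset.mem_range]
    rw [hn] at hi
    split_ifs <;> first | contradiction | omega | simp

lemma matrixT_diag (k m : ℕ) (c : ℝ) (i : Fin (m + 2)) :
    matrixT k (m + 2) c i i = if (i : ℕ) = m + 1 then k - c else 0 := by
  have h : offDiagT k (m + 2) c i i = 0 := by simp [offDiagT]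
  rw [matrixT, Matrix.add_apply, h, Matrix.diagonal_apply_eq, sum_offDiagT]
  split_ifs <;> simp

/-- Entrywise description of the matrix `X - T(k,m+2,c)`. -/
lemma charmatrix_matrixT_apply (k m : ℕ) (c : ℝ) (i j : Fin (m + 2)) :
    (matrixT k (m + 2) c).charmatrix i j =
      (if (i : ℕ) = j then X - C (if (j : ℕ) = m + 1 then (k : ℝ) - c else 0) else 0)
      + (if (i : ℕ) = j + 1 then - C (if (j : ℕ) = m then c else 1) else 0)
      + (if (i : ℕ) + 1 = j then - C (upperEntry k i) else 0) := by
  by_cases h : i = j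
  · subst h
    simp [charmatrix_apply_eq, matrixT_diag]
  have h' : (i : ℕ) ≠ j := fun e => h (Fin.ext e)
  rw [charmatrix_apply_ne _ _ _ h, if_neg h']
  by_cases h1 : (i : ℕ) = j + 1
  · have h3 : ¬ (i : ℕ) + 1 = j := by omega
    rw [matrixT_apply_of_eq_succ _ _ _ h1, if_pos h1, if_neg h3, h1]
    simp
  by_cases h2 : (j : ℕ) = i + 1
  · rw [matrixT_apply_of_succ_eq _ _ _ h2, if_neg h1, if_pos h2.symm]
    simp
  · rw [matrixT_apply_of_far _ _ _ h2 h1 h]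
    simp [h1, Ne.symm h2]

/-- The polynomial left eigenvector of `T(k,m+2,c)`. -/
noncomputable def leftVec (k c : ℝ) (m n : ℕ) : ℝ[X] :=
  if n = m + 1 then C c⁻¹ * nonbacktrackingPoly k n else nonbacktrackingPoly k n

/-- All columns but the last vanish by the recurrence of the `F_n`; the factor `c⁻¹` in the last
coordinate offsets the entry `c` of the lower diagonal. -/
lemma sum_leftVec_mul_charmatrix (k m : ℕ) {c : ℝ} (hc : 0 < c) (j : Fin (m + 2)) :
    ∑ i : Fin (m + 2), leftVec k c m i * (matrixT k (m + 2) c).charmatrix i j =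
      if (j : ℕ) = m + 1 then C c⁻¹ * ((X - C (k : ℝ)) * quotientPoly k c m) else 0 := by
  have hcc : C c⁻¹ * C c = (1 : ℝ[X]) := by rw [← C_mul, inv_mul_cancel₀ hc.ne', C_1]
  let f : ℕ → ℝ[X] := fun n => (if n = j then
      leftVec k c m n * (X - C (if (j : ℕ) = m + 1 then (k : ℝ) - c else 0)) else 0)
    + (if n = j + 1 then leftVec k c m n * - C (if (j : ℕ) = m then c else 1) else 0)
    + (if n + 1 = j then leftVec k c m n * - C (upperEntry k n) else 0)
  have h : ∀ i : Fin (m + 2),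
      leftVec k c m i * (matrixT k (m + 2) c).charmatrix i j = f i := by
    intro i
    rw [charmatrix_matrixT_apply]
    simp only [f, mul_add, mul_ite, mul_zero]
  rw [Finset.sum_congr rfl fun j _ => h j, Fin.sum_univ_eq_sum_range f]
  simp only [f]
  rw [Finset.sum_add_distrib, Finset.sum_add_distrib, Finset.sum_ite_eq', Finset.sum_ite_eq']
  have hj := j.2
  have hq := X_sub_mul_nonbacktrackingSum (k : ℝ) m
  clear h f
  generalize (j : ℕ) = j at hj ⊢
  obtain _ | n := j
  · obtain _ | m := m
    · simp [leftVec, nonbacktrackingPoly]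
      linear_combination (-X) * hcc
    · simp [leftVec, nonbacktrackingPoly]
  · have hn : n < m + 2 := by omega
    simp only [add_left_inj, Finset.sum_ite_eq', Finset.mem_range, if_pos hj, if_pos hn]
    by_cases h1 : n = m
    · subst h1
      have h3 : ¬ n = n + 1 := by omega
      simp only [leftVec, quotientPoly, lt_self_iff_false, if_true, if_false, C_sub, if_neg h3]
      linear_combination ((X - C (k : ℝ)) * -nonbacktrackingSum (k : ℝ) n
        + nonbacktrackingPoly (k : ℝ) (n + 1)) * hcc - hq
    · have h3 : n + 1 + 1 < m + 2 := by omega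
      have h4 : ¬ n = m + 1 := by omega
      simp only [leftVec, nonbacktrackingPoly_add_two, add_left_inj, if_neg h1, if_pos h3, if_neg h4]
      by_cases h2 : n + 1 = m
      · simp only [h2, if_true, C_0]
        linear_combination (- X * nonbacktrackingPoly (k : ℝ) m
          + C (upperEntry (k : ℝ) n) * nonbacktrackingPoly (k : ℝ) n) * hcc
      · simp only [h2, if_false, C_0, C_1]
        ring

/-- The characteristic polynomial of `T(k,m+2,c)`. -/
lemma charpoly_matrixT (k m : ℕ) {c : ℝ} (hc : 0 < c) :
    (matrixT k (m + 2) c).charpoly = (X - C (k : ℝ)) * quotientPoly k c m := by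
  set N := (matrixT k (m + 2) c).charmatrix with hN
  -- Row `0` has coefficient `F_0 = 1`, so replacing it by the combination of all rows preserves the
  -- determinant and leaves only the last entry of that row nonzero.
  have h1 := det_updateRow_sum N 0 fun i => leftVec k c m i
  have h0 : leftVec k c m ((0 : Fin (m + 2)) : ℕ) = 1 := by simp [leftVec, nonbacktrackingPoly]
  have hrow : ∑ i : Fin (m + 2), leftVec k c m i • N i =
      fun j : Fin (m + 2) => if (j : ℕ) = m + 1 then
        C c⁻¹ * ((X - C (k : ℝ)) * quotientPoly k c m) else 0 := by
    funext j
    rw [← sum_leftVec_mul_charmatrix k m hc j, Finset.sum_apply]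
    rfl
  rw [hrow, h0, one_smul] at h1
  rw [charpoly, ← hN, ← h1, det_succ_row_zero, Finset.sum_eq_single (Fin.last (m + 1))]
  -- The remaining minor is triangular with diagonal `-1, …, -1, -c`: its sign cancels that of the
  -- cofactor, its `c` cancels `c⁻¹`.
  · have htri : ((N.updateRow 0 fun j : Fin (m + 2) => if (j : ℕ) = m + 1 then
        C c⁻¹ * ((X - C (k : ℝ)) * quotientPoly k c m) else 0).submatrix Fin.succ
          (Fin.last (m + 1)).succAbove).det = (-1) ^ (m + 1) * C c := by
      rw [det_of_isUpperTriangular]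
      · have hd : ∀ i : Fin (m + 1), (N.updateRow 0 fun j : Fin (m + 2) => if (j : ℕ) = m + 1 then
            C c⁻¹ * ((X - C (k : ℝ)) * quotientPoly k c m) else 0).submatrix Fin.succ
            (Fin.last (m + 1)).succAbove i i = (-1) * if i = Fin.last m then C c else 1 := by
          intro i
          have hi : i = Fin.last m ↔ (i : ℕ) = m := by rw [Fin.ext_iff]; rfl
          rw [submatrix_apply, updateRow_ne (Fin.succ_ne_zero i), Fin.succAbove_last, hN,
            charmatrix_matrixT_apply]
          have h2 : ¬ (i : ℕ) + 1 = i := by omega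
          have h3 : ¬ (i : ℕ) + 1 + 1 = i := by omega
          simp only [hi, Fin.val_succ, Fin.val_castSucc, if_neg h2, if_neg h3, if_true]
          split_ifs <;> simp
        rw [Finset.prod_congr rfl fun i _ => hd i, Finset.prod_mul_distrib]
        simp
      · intro i j hij
        have hij' : (j : ℕ) < i := hij
        rw [submatrix_apply, updateRow_ne (Fin.succ_ne_zero i), Fin.succAbove_last, hN,
            charmatrix_matrixT_apply]
        have h2 : ¬ (i : ℕ) + 1 = j := by omega
        have h3 : ¬ (i : ℕ) + 1 + 1 = j := by omega
        have h4 : ¬ (i : ℕ) = j := by omega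
        simp [h2, h3, h4]
    have hcc : C c⁻¹ * C c = (1 : ℝ[X]) := by rw [← C_mul, inv_mul_cancel₀ hc.ne', C_1]
    have hs : ((-1 : ℝ[X]) ^ (m + 1)) * (-1) ^ (m + 1) = 1 := by
      rw [← mul_pow]; simp
    rw [htri, updateRow_self]
    simp only [Fin.val_last, if_true]
    linear_combination (C c⁻¹ * C c * (X - C (k : ℝ)) * quotientPoly k c m) * hs +
      (X - C (k : ℝ)) * quotientPoly k c m * hcc
  · intro j _ hj
    have : (j : ℕ) ≠ m + 1 := fun h => hj (Fin.ext h)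
    simp [this]
  · simp

/-! ### The second eigenvalue of `T`. -/

/-- If `a` is a largest eigenvalue, the second eigenvalue is the largest of the others. -/
lemma secondEigenvalue_eq_of_roots {n : Type*} [Fintype n] [DecidableEq n] (A : Matrix n n ℝ)
    {a : ℝ} {R : Multiset ℝ} (h : A.charpoly.roots = a ::ₘ R) (hR : ∀ x ∈ R, x ≤ a) :
    secondEigenvalue A = (R.sort (· ≥ ·)).getD 0 0 := by
  rw [secondEigenvalue, nthLargestEigenvalue, h, Multiset.sort_cons _ _ _ hR]
  rfl

lemma getD_sort_zero {R : Multiset ℝ} (hR : R ≠ 0) :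
    (R.sort (· ≥ ·)).getD 0 0 ∈ R ∧ ∀ x ∈ R, x ≤ (R.sort (· ≥ ·)).getD 0 0 := by
  have hp := R.pairwise_sort (· ≥ ·)
  have hm : ∀ x, x ∈ R.sort (· ≥ ·) ↔ x ∈ R := fun x => Multiset.mem_sort _
  generalize R.sort (· ≥ ·) = L at hp hm
  obtain _ | ⟨a, L⟩ := L
  · exact absurd (Multiset.eq_zero_of_forall_notMem fun x hx => by simpa using (hm x).2 hx) hR
  · refine ⟨(hm _).1 (by simp), fun x hx => ?_⟩
    obtain rfl | hx := List.mem_cons.1 ((hm x).2 hx)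
    · simp
    · exact List.rel_of_pairwise_cons hp hx

/-- The second eigenvalue of `T(k,m+2,c)` is the largest root of `F_{m+1} + c G_m`, and it is
smaller than `k`. -/
lemma secondEigenvalue_matrixT {k m : ℕ} {c : ℝ} (hk : 2 ≤ k) (hc : 0 < c) :
    secondEigenvalue (matrixT k (m + 2) c) < k ∧
      (quotientPoly k c m).eval (secondEigenvalue (matrixT k (m + 2) c)) = 0 ∧
      ∀ x, secondEigenvalue (matrixT k (m + 2) c) ≤ x → 0 ≤ (quotientPoly k c m).eval x := by
  have hk' : (2 : ℝ) ≤ k := by exact_mod_cast hk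
  have hS0 : quotientPoly k c m ≠ 0 := fun h => by
    have := eval_quotientPoly_pos hk' hc le_rfl m
    simp [h] at this
  have hlt : ∀ x, (quotientPoly k c m).eval x = 0 → x < k := by
    intro x hx
    by_contra! h
    exact (eval_quotientPoly_pos hk' hc h m).ne' hx
  have hch := charpoly_matrixT k m hc
  have hroots : (matrixT k (m + 2) c).charpoly.roots = (k : ℝ) ::ₘ (quotientPoly k c m).roots := by
    rw [hch, roots_mul (mul_ne_zero (X_sub_C_ne_zero _) hS0), roots_X_sub_C]
    rfl
  have hR : ∀ x ∈ (quotientPoly k c m).roots, x < k := fun x hx => hlt x (isRoot_of_mem_roots hx)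
  have hne : (quotientPoly k c m).roots ≠ 0 := by
    intro h
    have hcard := (matrixT_charpoly_splits k (m + 2) c hk hc).natDegree_eq_card_roots
    rw [hroots, h, charpoly_natDegree_eq_dim] at hcard
    simp at hcard
  obtain ⟨hmem, hmax⟩ := getD_sort_zero hne
  rw [secondEigenvalue_eq_of_roots _ hroots fun x hx => (hR x hx).le]
  set l := ((quotientPoly k c m).roots.sort (· ≥ ·)).getD 0 0
  have hl0 : (quotientPoly k c m).eval l = 0 := isRoot_of_mem_roots hmem
  refine ⟨hR l hmem, hl0, fun x hx => ?_⟩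
  -- Since `Q(k) > 0`, a negative value beyond `l` would force a root of `Q` beyond `l`.
  by_contra! hneg
  have hxk : x < k := by
    by_contra! h
    exact absurd (eval_quotientPoly_pos hk' hc h m) (not_lt.2 hneg.le)
  obtain ⟨y, hy, hy0⟩ := intermediate_value_Icc hxk.le
    (quotientPoly k c m).continuous.continuousOn
    (⟨hneg.le, (eval_quotientPoly_pos hk' hc le_rfl m).le⟩ : (0 : ℝ) ∈ Set.Icc _ _)
  have hyl := hmax y ((mem_roots hS0).2 hy0)
  have : x = l := le_antisymm (hy.1.trans hyl) hx
  rw [this, hl0] at hneg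
  exact lt_irrefl _ hneg

/-! ### Counting nonbacktracking walks in a regular graph. -/

section Walks

variable {V : Type*} [Fintype V] {H : SimpleGraph V} [DecidableRel H.Adj] {k : ℕ}

lemma adjMatrix_mulVec_one (hreg : H.IsRegularOfDegree k) :
    H.adjMatrix ℝ *ᵥ (fun _ => 1) = (k : ℝ) • fun _ => 1 := by
  funext x
  simp [hreg.degree_eq]

lemma sum_adjMatrix_column (hreg : H.IsRegularOfDegree k) (y : V) :
    ∑ z, H.adjMatrix ℝ z y = k := by
  have h : ∀ z, H.adjMatrix ℝ z y = H.adjMatrix ℝ y z := fun z => by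
    simp [SimpleGraph.adjMatrix_apply, H.adj_comm]
  rw [Finset.sum_congr rfl fun z _ => h z]
  have h1 := congrFun (adjMatrix_mulVec_one hreg) y
  simp only [Matrix.mulVec, dotProduct, mul_one, Pi.smul_apply, smul_eq_mul] at h1
  exact h1

variable [DecidableEq V]

variable (H) in
/-- The number of nonbacktracking walks of length `n + 1` from `x` to `y` whose last step starts
at `z`. -/
def nonbacktrackingCount (x : V) : ℕ → V → V → ℕ
  | 0, z, y => if x = z ∧ H.Adj z y then 1 else 0
  | n + 1, z, y => if H.Adj z y then ∑ w ∈ Finset.univ.erase y, nonbacktrackingCount x n w z else 0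

variable (H) in
lemma adjMatrix_mul_nonbacktrackingCount (x : V) (n : ℕ) (z y : V) :
    H.adjMatrix ℝ z y * (nonbacktrackingCount H x n z y : ℝ) = nonbacktrackingCount H x n z y := by
  by_cases h : H.Adj z y
  · simp [h]
  · cases n <;> simp [nonbacktrackingCount, h]

variable (H) in
lemma nonbacktrackingCount_succ (x : V) (n : ℕ) (z y : V) :
    (nonbacktrackingCount H x (n + 1) z y : ℝ) = H.adjMatrix ℝ z y *
      (∑ w, (nonbacktrackingCount H x n w z : ℝ) - nonbacktrackingCount H x n y z) := by
  have h := Finset.sum_erase_eq_sub (f := fun w => (nonbacktrackingCount H x n w z : ℝ))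
    (Finset.mem_univ y)
  rw [← h]
  by_cases h : H.Adj z y <;> simp [nonbacktrackingCount, h]

/-- For a `k`-regular graph, `F_{n+1}(A)` counts the nonbacktracking walks of length `n + 1`. -/
lemma sum_nonbacktrackingCount (hreg : H.IsRegularOfDegree k) (x : V) (n : ℕ) :
    (∀ y, ∑ z, (nonbacktrackingCount H x n z y : ℝ) =
      aeval (H.adjMatrix ℝ) (nonbacktrackingPoly k (n + 1)) x y) ∧
    ∀ y, ∑ z, H.adjMatrix ℝ z y * (nonbacktrackingCount H x n y z : ℝ) =
      upperEntry k n * aeval (H.adjMatrix ℝ) (nonbacktrackingPoly k n) x y := by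
  -- The second conjunct counts walks extended by a step from `y` to `z` and then turned back to
  -- `y`: each walk of length `n` ending at `y` has `k - 1` such extensions, or `k` if `n = 0`.
  -- These are the walks the recurrence subtracts.
  induction n with
  | zero =>
    refine ⟨fun y => ?_, fun y => ?_⟩
    · simp [nonbacktrackingCount, nonbacktrackingPoly, SimpleGraph.adjMatrix_apply, ite_and]
    · have h : ∀ z, H.adjMatrix ℝ z y * (nonbacktrackingCount H x 0 y z : ℝ) =
          H.adjMatrix ℝ z y * (1 : Matrix V V ℝ) x y := fun z => by
        by_cases h : H.Adj z y <;> simp [nonbacktrackingCount, Matrix.one_apply, h, H.adj_comm y z]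
      rw [Finset.sum_congr rfl fun z _ => h z, ← Finset.sum_mul, sum_adjMatrix_column hreg]
      simp [nonbacktrackingPoly, upperEntry]
  | succ n ih =>
    obtain ⟨ih1, ih2⟩ := ih
    refine ⟨fun y => ?_, fun y => ?_⟩
    · simp only [nonbacktrackingCount_succ, ih1]
      rw [nonbacktrackingPoly_add_two, mul_comm X, map_sub, map_mul, aeval_X, Matrix.sub_apply,
        Matrix.mul_apply, map_mul, aeval_C, ← Algebra.smul_def, Matrix.smul_apply, smul_eq_mul,
        ← ih2 y, ← Finset.sum_sub_distrib]
      exact Finset.sum_congr rfl fun z _ => by ring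
    · simp only [nonbacktrackingCount_succ, ih1]
      have h : ∀ z, H.adjMatrix ℝ z y * (H.adjMatrix ℝ y z *
          (aeval (H.adjMatrix ℝ) (nonbacktrackingPoly k (n + 1)) x y
            - nonbacktrackingCount H x n z y)) =
          H.adjMatrix ℝ z y * aeval (H.adjMatrix ℝ) (nonbacktrackingPoly k (n + 1)) x y
            - nonbacktrackingCount H x n z y := fun z => by
        rw [← adjMatrix_mul_nonbacktrackingCount]
        by_cases h : H.Adj z y
        · simp [h, h.symm]
        · simp [h]
      rw [Finset.sum_congr rfl fun z _ => h z, Finset.sum_sub_distrib, ← Finset.sum_mul, ih1,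
        sum_adjMatrix_column hreg]
      simp only [upperEntry, Nat.add_eq_zero_iff, one_ne_zero, and_false, if_false]
      ring

lemma exists_natCast_aeval_nonbacktrackingPoly (hreg : H.IsRegularOfDegree k) (n : ℕ) (x y : V) :
    ∃ a : ℕ, aeval (H.adjMatrix ℝ) (nonbacktrackingPoly k n) x y = a := by
  cases n with
  | zero => exact ⟨if x = y then 1 else 0, by simp [nonbacktrackingPoly, Matrix.one_apply]⟩
  | succ n => exact ⟨∑ z, nonbacktrackingCount H x n z y, by
      rw [← (sum_nonbacktrackingCount hreg x n).1 y]; push_cast; rfl⟩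

lemma aeval_mulVec_of_eigenvector {n : Type*} [Fintype n] [DecidableEq n] {A : Matrix n n ℝ}
    {v : n → ℝ} {a : ℝ} (h : A *ᵥ v = a • v) (p : ℝ[X]) : aeval A p *ᵥ v = p.eval a • v := by
  induction p using Polynomial.induction_on' with
  | add p q hp hq => simp [Matrix.add_mulVec, hp, hq, add_smul]
  | monomial i b =>
    have hpow : ∀ i : ℕ, A ^ i *ᵥ v = a ^ i • v := by
      intro i
      induction i with
      | zero => simp
      | succ i ih => rw [pow_succ, ← Matrix.mulVec_mulVec, h, Matrix.mulVec_smul, ih, smul_smul,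
          pow_succ, mul_comm]
    rw [aeval_monomial, ← Algebra.smul_def, Matrix.smul_mulVec, hpow, eval_monomial, smul_smul]

lemma transpose_aeval {n : Type*} [Fintype n] [DecidableEq n] {A : Matrix n n ℝ} (h : Aᵀ = A)
    (p : ℝ[X]) : (aeval A p)ᵀ = aeval A p := by
  induction p using Polynomial.induction_on' with
  | add p q hp hq => simp [hp, hq]
  | monomial i b =>
    rw [aeval_monomial, ← Algebra.smul_def, Matrix.transpose_smul, Matrix.transpose_pow, h]

lemma sum_aeval_nonbacktrackingPoly (hreg : H.IsRegularOfDegree k) (n : ℕ) :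
    ∑ x, ∑ y, aeval (H.adjMatrix ℝ) (nonbacktrackingPoly k n) x y =
      Fintype.card V * (nonbacktrackingPoly k n).eval (k : ℝ) := by
  have h : ∀ x, ∑ y, aeval (H.adjMatrix ℝ) (nonbacktrackingPoly k n) x y =
      (nonbacktrackingPoly k n).eval (k : ℝ) := fun x => by
    have := congrFun (aeval_mulVec_of_eigenvector (adjMatrix_mulVec_one hreg)
      (nonbacktrackingPoly k n)) x
    simpa [Matrix.mulVec, dotProduct] using this
  simp [h]

lemma trace_aeval_mul {n : Type*} [Fintype n] [DecidableEq n] {A : Matrix n n ℝ} (h : Aᵀ = A)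
    (p q : ℝ[X]) : (aeval A (p * q)).trace = ∑ x, ∑ y, aeval A p x y * aeval A q x y := by
  rw [map_mul, ← transpose_aeval h q]
  simp [Matrix.trace, Matrix.mul_apply, transpose_aeval h q]

lemma trace_nonbacktrackingPoly_mul_nonneg (hreg : H.IsRegularOfDegree k) (i j : ℕ) :
    0 ≤ (aeval (H.adjMatrix ℝ) (nonbacktrackingPoly k i * nonbacktrackingPoly k j)).trace := by
  rw [trace_aeval_mul (H.transpose_adjMatrix)]
  refine Finset.sum_nonneg fun x _ => Finset.sum_nonneg fun y _ => ?_
  obtain ⟨a, ha⟩ := exists_natCast_aeval_nonbacktrackingPoly hreg i x y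
  obtain ⟨b, hb⟩ := exists_natCast_aeval_nonbacktrackingPoly hreg j x y
  rw [ha, hb]
  positivity

/-- The trace is the sum of squared entries, and `a ≤ a²` for natural numbers; the entries
themselves sum to the left side because the all-ones vector is an eigenvector. -/
lemma card_mul_eval_le_trace_nonbacktrackingPoly_mul_self (hreg : H.IsRegularOfDegree k) (i : ℕ) :
    Fintype.card V * (nonbacktrackingPoly k i).eval (k : ℝ) ≤
      (aeval (H.adjMatrix ℝ) (nonbacktrackingPoly k i * nonbacktrackingPoly k i)).trace := by
  rw [trace_aeval_mul (H.transpose_adjMatrix), ← sum_aeval_nonbacktrackingPoly hreg]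
  refine Finset.sum_le_sum fun x _ => Finset.sum_le_sum fun y _ => ?_
  obtain ⟨a, ha⟩ := exists_natCast_aeval_nonbacktrackingPoly hreg i x y
  rw [ha]
  exact_mod_cast Nat.le_mul_self a

/-- Expand both sums and discard the nonnegative cross terms; `j ≤ m` guarantees that each `F_i²`
with `i ≤ j` occurs. -/
lemma card_mul_eval_le_trace_nonbacktrackingSum_mul (hreg : H.IsRegularOfDegree k) {j m : ℕ}
    (hj : j ≤ m) : Fintype.card V * (nonbacktrackingSum k j).eval (k : ℝ) ≤
      (aeval (H.adjMatrix ℝ) (nonbacktrackingSum k m * nonbacktrackingSum k j)).trace := by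
  rw [mul_comm (nonbacktrackingSum (k : ℝ) m), nonbacktrackingSum, nonbacktrackingSum,
    eval_finsetSum, Finset.mul_sum, Finset.sum_mul, map_sum, Matrix.trace_sum]
  refine Finset.sum_le_sum fun i hi => ?_
  rw [Finset.mul_sum, map_sum, Matrix.trace_sum]
  refine (card_mul_eval_le_trace_nonbacktrackingPoly_mul_self hreg i).trans ?_
  refine Finset.single_le_sum (f := fun l => (aeval (H.adjMatrix ℝ)
    (nonbacktrackingPoly k i * nonbacktrackingPoly k l)).trace)
    (fun l _ => trace_nonbacktrackingPoly_mul_nonneg hreg i l) ?_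
  simp only [Finset.mem_range] at hi ⊢
  omega

end Walks

/-! ### Traces and eigenvalues of symmetric matrices. -/

section Spectrum

variable {n : Type*} [Fintype n] [DecidableEq n] {A : Matrix n n ℝ}

lemma trace_aeval_eq_sum_roots (hA : A.IsHermitian) (p : ℝ[X]) :
    (aeval A p).trace = (A.charpoly.roots.map fun x => p.eval x).sum := by
  have h : aeval A p = Unitary.conjStarAlgAut ℝ _ hA.eigenvectorUnitary
      (aeval (diagonal hA.eigenvalues) p) := by
    conv_lhs => rw [hA.spectral_theorem]
    exact Polynomial.aeval_algHom_apply
      ((Unitary.conjStarAlgAut ℝ (Matrix n n ℝ) hA.eigenvectorUnitary :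
        Matrix n n ℝ ≃⋆ₐ[ℝ] Matrix n n ℝ).toAlgEquiv : Matrix n n ℝ →ₐ[ℝ] Matrix n n ℝ) _ p
  have hd : aeval (diagonal hA.eigenvalues) p = diagonal fun i => p.eval (hA.eigenvalues i) := by
    have := Polynomial.aeval_algHom_apply (Matrix.diagonalAlgHom (n := n) (α := ℝ) ℝ)
      hA.eigenvalues p
    rw [Matrix.diagonalAlgHom_apply, Matrix.diagonalAlgHom_apply] at this
    rw [this]
    congr 1
    funext i
    rw [Polynomial.aeval_pi_apply]
    simp
  rw [h, hd, Unitary.conjStarAlgAut_apply, Matrix.trace_mul_cycle, Unitary.coe_star_mul_self,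
    one_mul, Matrix.trace_diagonal, hA.roots_charpoly_eq_eigenvalues, Multiset.map_map]
  rfl

/-- An eigenvalue above the second eigenvalue is the largest one. -/
lemma exists_roots_charpoly_eq_cons {a : ℝ} (ha : a ∈ A.charpoly.roots)
    (h : secondEigenvalue A < a) :
    ∃ R : Multiset ℝ, A.charpoly.roots = a ::ₘ R ∧ ∀ x ∈ R, x ≤ secondEigenvalue A := by
  have hp := A.charpoly.roots.pairwise_sort (· ≥ ·)
  have hL : ((A.charpoly.roots.sort (· ≥ ·) : List ℝ) : Multiset ℝ) = A.charpoly.roots :=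
    Multiset.sort_eq _ _
  unfold secondEigenvalue nthLargestEigenvalue at h ⊢
  generalize A.charpoly.roots.sort (· ≥ ·) = L at hp hL h
  rw [← hL] at ha ⊢
  obtain _ | ⟨b, L⟩ := L
  · simp at ha
  · have hmax : ∀ x ∈ L, x ≤ (b :: L).getD 1 0 := by
      intro x hx
      -- With a single eigenvalue the default `0` is read off, but there is then nothing to bound.
      obtain _ | ⟨d, L⟩ := L
      · simp at hx
      · obtain rfl | hx := List.mem_cons.1 hx
        · simp
        · exact List.rel_of_pairwise_cons (List.pairwise_cons.1 hp).2 hx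
    have hab : a = b := by
      obtain hab | hab := List.mem_cons.1 (Multiset.mem_coe.1 ha)
      · exact hab
      · exact absurd (hmax a hab) (not_le.2 h)
    exact ⟨L, by rw [hab]; rfl, fun x hx => hmax x hx⟩

lemma mem_roots_charpoly_of_eigenvector {v : n → ℝ} (hv : v ≠ 0) {a : ℝ} (h : A *ᵥ v = a • v) :
    a ∈ A.charpoly.roots := by
  rw [Polynomial.mem_roots A.charpoly_monic.ne_zero, IsRoot, Matrix.eval_charpoly,
    ← Matrix.exists_mulVec_eq_zero_iff]
  exact ⟨v, hv, by simp [Matrix.sub_mulVec, h, Matrix.scalar_apply, ← Matrix.smul_one_eq_diagonal,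
    Matrix.smul_mulVec]⟩

end Spectrum

/-! ### The linear programming argument. -/

/-- The linear programming bound: a `k`-regular graph whose second eigenvalue is at most that of
`T(k,m+2,c)` has at most `M(k,m+2,c)` vertices, and fewer if the inequality is strict. -/
lemma card_le_boundM_of_secondEigenvalue_le {V : Type*} [Fintype V] [DecidableEq V] [Nonempty V]
    {H : SimpleGraph V} [DecidableRel H.Adj] {k m : ℕ} {c : ℝ} (hk : 2 ≤ k) (hc : 0 < c)
    (hreg : H.IsRegularOfDegree k)
    (hle : graphSecondEigenvalue H ≤ secondEigenvalue (matrixT k (m + 2) c)) :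
    (Fintype.card V : ℝ) ≤ boundM k (m + 2) c ∧
      (graphSecondEigenvalue H < secondEigenvalue (matrixT k (m + 2) c) →
        (Fintype.card V : ℝ) < boundM k (m + 2) c) := by
  have hk' : (2 : ℝ) ≤ k := by exact_mod_cast hk
  obtain ⟨hlk, hl0, hlS⟩ := secondEigenvalue_matrixT (m := m) hk hc
  set l := secondEigenvalue (matrixT k (m + 2) c)
  have hGl : ∀ j ≤ m, 0 < (nonbacktrackingSum (k : ℝ) j).eval l := fun j hj =>
    eval_nonbacktrackingSum_pos_of_root hk' hlS hj
  have hkpow : ∀ j : ℕ, 0 < ((k : ℝ) - 1) ^ j := fun j => pow_pos (by linarith) j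
  set w : ℕ → ℝ := fun j => (nonbacktrackingSum (k : ℝ) j).eval l / ((k : ℝ) - 1) ^ j with hw
  have hwpos : ∀ j ≤ m, 0 < w j := fun j hj => div_pos (hGl j hj) (hkpow j)
  set p : ℝ[X] := ∑ j ∈ Finset.range (m + 1), C (w j) * nonbacktrackingSum (k : ℝ) j with hp
  have hfactor : (X - C l) * p = C (w m) * quotientPoly k c m := by
    rw [hp, hw, christoffel_darboux (by linarith) l m]
    have h0 : (nonbacktrackingPoly (k : ℝ) (m + 1)).eval l =
        -(c * (nonbacktrackingSum (k : ℝ) m).eval l) := by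
      simp only [quotientPoly, eval_add, eval_mul, eval_C] at hl0
      linarith
    rw [nonbacktrackingSum_succ, eval_add, h0, quotientPoly]
    refine Polynomial.funext fun x => ?_
    simp only [eval_mul, eval_add, eval_sub, eval_C]
    ring
  have hpk : 0 < p.eval (k : ℝ) := by
    simp only [hp, eval_finsetSum, eval_mul, eval_C]
    refine Finset.sum_pos (fun j hj => mul_pos (hwpos j ?_)
      (eval_nonbacktrackingSum_pos hk' le_rfl j)) ⟨0, by simp⟩
    exact Nat.lt_succ_iff.1 (Finset.mem_range.1 hj)
  set A := H.adjMatrix ℝ with hA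
  have hherm : A.IsHermitian := H.isHermitian_adjMatrix ℝ
  have htrace_sum : ∀ q : ℝ[X], (aeval A (q * p)).trace =
      ∑ j ∈ Finset.range (m + 1), w j * (aeval A (q * nonbacktrackingSum (k : ℝ) j)).trace := by
    intro q
    rw [hp, Finset.mul_sum, map_sum, Matrix.trace_sum]
    refine Finset.sum_congr rfl fun j _ => ?_
    rw [mul_left_comm, ← smul_eq_C_mul, map_smul, Matrix.trace_smul, smul_eq_mul]
  have hFp : 0 ≤ (aeval A (nonbacktrackingPoly (k : ℝ) (m + 1) * p)).trace := by
    rw [htrace_sum]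
    refine Finset.sum_nonneg fun j hj => mul_nonneg
      (hwpos j (Nat.lt_succ_iff.1 (Finset.mem_range.1 hj))).le ?_
    rw [nonbacktrackingSum, Finset.mul_sum, map_sum, Matrix.trace_sum]
    exact Finset.sum_nonneg fun i _ => trace_nonbacktrackingPoly_mul_nonneg hreg _ i
  have hGp : Fintype.card V * p.eval (k : ℝ) ≤
      (aeval A (nonbacktrackingSum (k : ℝ) m * p)).trace := by
    rw [htrace_sum, hp, eval_finsetSum, Finset.mul_sum]
    refine Finset.sum_le_sum fun j hj => ?_
    have hj' := Nat.lt_succ_iff.1 (Finset.mem_range.1 hj)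
    rw [eval_mul, eval_C, mul_left_comm]
    exact mul_le_mul_of_nonneg_left (card_mul_eval_le_trace_nonbacktrackingSum_mul hreg hj')
      (hwpos j hj').le
  have hSp : (aeval A (quotientPoly k c m * p)).trace =
      (aeval A (nonbacktrackingPoly (k : ℝ) (m + 1) * p)).trace +
        c * (aeval A (nonbacktrackingSum (k : ℝ) m * p)).trace := by
    rw [quotientPoly, add_mul, map_add, Matrix.trace_add, mul_assoc, ← smul_eq_C_mul, map_smul,
      Matrix.trace_smul, smul_eq_mul]
  have hmem : (k : ℝ) ∈ A.charpoly.roots :=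
    mem_roots_charpoly_of_eigenvector (fun h => one_ne_zero
      (congrFun h (Classical.arbitrary V))) (adjMatrix_mulVec_one hreg)
  -- Since `λ₂(H) ≤ l < k`, the eigenvalue `k` is simple and `R` lists the others.
  obtain ⟨R, hR, hRle⟩ := exists_roots_charpoly_eq_cons hmem (hle.trans_lt hlk)
  have hRl : ∀ x ∈ R, x ≤ l := fun x hx => (hRle x hx).trans hle
  -- The spectral evaluation of `tr((A - l) p(A)²)`, with the nonpositive contribution of `R` moved
  -- to the left.
  have hupper : w m * (aeval A (quotientPoly k c m * p)).trace +
      (R.map fun x => (l - x) * p.eval x ^ 2).sum =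
      w m * (c * boundM k (m + 2) c) * p.eval (k : ℝ) := by
    have h1 : w m * (aeval A (quotientPoly k c m * p)).trace =
        (aeval A ((X - C l) * p * p)).trace := by
      rw [hfactor, mul_assoc, ← smul_eq_C_mul, map_smul, Matrix.trace_smul, smul_eq_mul]
    have h2 := congrArg (eval (k : ℝ)) hfactor
    rw [eval_mul (p := C (w m)), eval_C, eval_quotientPoly_self hc] at h2
    rw [h1, trace_aeval_eq_sum_roots hherm, hR, Multiset.map_cons, Multiset.sum_cons, ← h2,
      eval_mul, add_assoc, ← Multiset.sum_map_add]
    have h3 : ∀ x ∈ R, eval x ((X - C l) * p * p) + (l - x) * p.eval x ^ 2 = 0 := by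
      intro x _
      simp only [eval_mul, eval_sub, eval_X, eval_C]
      ring
    rw [Multiset.map_congr rfl h3]
    simp
  have hnonneg : ∀ y ∈ R.map fun x => (l - x) * p.eval x ^ 2, 0 ≤ y := by
    intro y hy
    obtain ⟨x, hx, rfl⟩ := Multiset.mem_map.1 hy
    exact mul_nonneg (sub_nonneg.2 (hRl x hx)) (sq_nonneg _)
  have hRsum := Multiset.sum_nonneg hnonneg
  have hwm := hwpos m le_rfl
  rw [hSp] at hupper
  have hwc : 0 < w m * c * p.eval (k : ℝ) := by positivity
  have h1 := mul_le_mul_of_nonneg_left hGp (mul_pos hwm hc).le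
  have h2 := mul_nonneg hwm.le hFp
  refine ⟨?_, fun hlt => ?_⟩
  · refine le_of_mul_le_mul_left ?_ hwc
    linarith
  · by_contra! hge
    have h3 := mul_le_mul_of_nonneg_left hge hwc.le
    -- With `|V| ≥ M` the two evaluations leave no slack, so each term `(l - x) p(x)²` is zero,
    -- while `l - x > 0`.
    have hzero : ∀ x ∈ R, p.eval x = 0 := by
      intro x hx
      have h4 := Multiset.single_le_sum hnonneg _ (Multiset.mem_map_of_mem _ hx)
      have h5 : 0 < l - x := sub_pos.2 ((hRle x hx).trans_lt hlt)
      have h6 : (l - x) * p.eval x ^ 2 ≤ 0 := by linarith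
      have h7 : p.eval x ^ 2 ≤ 0 := by
        by_contra! h
        exact absurd (mul_pos h5 h) (not_lt.2 h6)
      exact pow_eq_zero_iff two_ne_zero |>.1 (le_antisymm h7 (sq_nonneg _))
    have hpos : 0 < (aeval A (nonbacktrackingPoly (k : ℝ) (m + 1) * p)).trace := by
      have h4 : ∀ x ∈ R, eval x (nonbacktrackingPoly (k : ℝ) (m + 1) * p) = 0 := fun x hx => by
        rw [eval_mul, hzero x hx, mul_zero]
      rw [trace_aeval_eq_sum_roots hherm, hR, Multiset.map_cons, Multiset.sum_cons,
        Multiset.map_congr rfl h4, eval_mul]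
      simpa using mul_pos (eval_nonbacktrackingPoly_pos hk' le_rfl (m + 1)) hpk
    have := mul_pos hwm hpos
    linarith

end RegularGraphBound

theorem mainTheorem12 {V : Type*} [Fintype V] [DecidableEq V] (H : SimpleGraph V)
    [DecidableRel H.Adj] (k t : ℕ) (c : ℝ) (hk : 2 ≤ k) (ht : 2 ≤ t) (hc : 0 < c)
    (hconn : H.Connected) (hreg : H.IsRegularOfDegree k)
    (hcard : RegularGraphBound.boundM k t c ≤ (Fintype.card V : ℝ)) :
    RegularGraphBound.secondEigenvalue (RegularGraphBound.matrixT k t c)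
        ≤ RegularGraphBound.graphSecondEigenvalue H ∧
      (RegularGraphBound.secondEigenvalue (RegularGraphBound.matrixT k t c)
          = RegularGraphBound.graphSecondEigenvalue H →
        (Fintype.card V : ℝ) = RegularGraphBound.boundM k t c) := by
  obtain ⟨m, rfl⟩ := Nat.exists_eq_add_of_le' ht
  have := hconn.nonempty
  refine ⟨?_, fun h => ?_⟩
  · by_contra! h
    exact absurd ((RegularGraphBound.card_le_boundM_of_secondEigenvalue_le hk hc hreg h.le).2 h)
      (not_lt.2 hcard)
  · exact le_antisymm
      (RegularGraphBound.card_le_boundM_of_secondEigenvalue_le hk hc hreg h.ge).1 hcard
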